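/- Let $\Sigma$ be a finite alphabet with at least two elements, and let $\mathrm{Pr}$ be the uniform probability measure on the $\sigma$-algebra on $\Sigma^\omega$ generated by the cylinder sets, i.e. the probability measure that assigns $1/|\Sigma|^n$ to the set of infinite words with a given prefix of length $n$. A language $L \subseteq \Sigma^\omega$ is $\omega$-regular if it is the language of a nondeterministic Büchi automaton with finitely many states, i.e. the set of infinite words having a run that starts in an initial state and visits accepting states infinitely often. If $L \subseteq \Sigma^\omega$ is $\omega$-regular and $\mathrm{Pr}(L) > 0$, then there exists a finite word $x \in \Sigma^*$ such that the set $\{w \in \Sigma^\omega : xw \in L\}$ is measurable and $\mathrm{Pr}\{w \in \Sigma^\omega : xw \in L\} = 1$. -/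

import Mathlib

open MeasureTheory

/-- The concatenation `x w` of a finite word `x` and an infinite word `w`. -/
def prependWord {A : Type*} (x : List A) (w : ℕ → A) : ℕ → A :=
  fun n => if h : n < x.length then x[n] else w (n - x.length)

/-- The cylinder set of a finite word `x`: the infinite words that have `x` as a prefix. -/
def wordCylinder {A : Type*} (x : List A) : Set (ℕ → A) :=
  {w | ∀ (i : ℕ) (h : i < x.length), w i = x[i]}

/-- The uniform probability measure on infinite words over a finite alphabet. -/
noncomputable def uniformWordMeasure (A : Type*) [Fintype A] [Nonempty A] [MeasurableSpace A] :
    Measure (ℕ → A) :=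
  Measure.infinitePi fun _ : ℕ => (PMF.uniformOfFintype A).toMeasure

/-- The set of infinite words accepted by a nondeterministic automaton under the Büchi condition:
`w` has a run that starts in an initial state and visits accepting states infinitely often. -/
def NFA.buchiLanguage {A Q : Type*} (M : NFA A Q) : Set (ℕ → A) :=
  {w | ∃ ρ : ℕ → Q, ρ 0 ∈ M.start ∧ (∀ i, ρ (i + 1) ∈ M.step (ρ i) (w i)) ∧
    {i | ρ i ∈ M.accept}.Infinite}

/-- A set of infinite words is ω-regular if it is accepted by a nondeterministic Büchi automaton
with finitely many states. -/
def IsOmegaRegular {A : Type*} (L : Set (ℕ → A)) : Prop :=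
  ∃ (Q : Type) (_ : Finite Q) (M : NFA A Q), M.buchiLanguage = L

theorem wordCylinder_eq_pi {A : Type*} [Nonempty A] (x : List A) :
    wordCylinder x =
      Set.pi (Finset.range x.length) fun i => {x.getD i (Classical.arbitrary A)} := by
  ext w
  simp only [wordCylinder, Set.mem_ofPred_eq, Set.mem_pi, Finset.coe_range, Set.mem_Iio,
    Set.mem_singleton_iff]
  refine forall₂_congr fun i h => ?_
  rw [List.getD_eq_getElem _ _ h]

/-- The measure of the cylinder set of a word of length `n` is `1 / |A| ^ n`. -/
theorem uniformWordMeasure_wordCylinder {A : Type*} [Fintype A] [Nonempty A] [MeasurableSpace A]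
    [MeasurableSingletonClass A] (x : List A) :
    uniformWordMeasure A (wordCylinder x) = 1 / (Fintype.card A : ENNReal) ^ x.length := by
  rw [wordCylinder_eq_pi, uniformWordMeasure, Measure.infinitePi_pi _ (by simp)]
  simp only [PMF.toMeasure_apply_singleton _ _ (measurableSet_singleton _),
    PMF.uniformOfFintype_apply, Finset.prod_const, Finset.card_range, one_div, ENNReal.inv_pow]

/-- The σ-algebra on infinite words is the one generated by the cylinder sets. -/
theorem measurableSpace_eq_generateFrom_wordCylinder (A : Type*) [Finite A] [Nonempty A]
    [MeasurableSpace A] [MeasurableSingletonClass A] :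
    (inferInstance : MeasurableSpace (ℕ → A)) =
      MeasurableSpace.generateFrom (Set.range (wordCylinder (A := A))) := by
  apply le_antisymm
  · refine iSup_le fun i => ?_
    rw [← measurable_iff_comap_le]
    refine @measurable_to_countable' A (ℕ → A) _ _
      (MeasurableSpace.generateFrom (Set.range (wordCylinder (A := A)))) _ fun a => ?_
    have h : (fun w : ℕ → A => w i) ⁻¹' {a} =
        ⋃ x ∈ {x : List A | x.length = i + 1 ∧ x[i]? = some a}, wordCylinder x := by
      ext w
      simp only [Set.mem_preimage, Set.mem_singleton_iff, Set.mem_iUnion, Set.mem_ofPred_eq]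
      constructor
      · rintro rfl
        exact ⟨(List.range (i + 1)).map w, by simp, by simp [wordCylinder]⟩
      · rintro ⟨x, ⟨hx, hi⟩, hw⟩
        have hlt : i < x.length := by omega
        rw [List.getElem?_eq_getElem hlt] at hi
        rw [hw i hlt]
        exact Option.some.inj hi
    rw [h]
    exact MeasurableSet.biUnion (Set.to_countable _) fun x _ =>
      MeasurableSpace.measurableSet_generateFrom ⟨x, rfl⟩
  · refine MeasurableSpace.generateFrom_le ?_
    rintro _ ⟨x, rfl⟩
    rw [wordCylinder_eq_pi]
    exact MeasurableSet.pi (Set.to_countable _) fun _ _ => measurableSet_singleton _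

/-!
Measurability of an ω-regular set `L` is a Ramsey argument. Whether a Büchi automaton accepts `w`
is determined by the blocks of any factorization of `w`, each block entering only through the
function that it induces on sets of states, with a mark for visits to accepting states. There are
finitely many such functions, so by additive Ramsey every word has a factorization with types
`s, e, e, …`. Membership in `L` depends only on the pair `(s, e)`, and the words of a given pair
form a Borel set once the existence of the factorization is replaced by a condition quantifying only
over positions.

For the zero-one part, `L` has finitely many left quotients, since an automaton for `L`, with its
initial states replaced by those reachable along `x`, recognizes the quotient by `x`. Let `c` be the
largest measure of a quotient. As `μ (L ∩ C) ≤ c μ C` for every cylinder `C`, the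
measures satisfy `μ|_L ≤ c μ`, and evaluation at `L` gives `μ L ≤ c μ L`, that is, `c ≥ 1`.
-/

theorem exists_mem_Ico_of_strictMono {N : ℕ → ℕ} (hN : StrictMono N) {k : ℕ} (hk : N 0 ≤ k) :
    ∃ i, k ∈ Set.Ico (N i) (N (i + 1)) := by
  have h := iUnion_Ico_map_succ_eq_Ici (f := N) (fun i => hN.monotone i.zero_le)
    hN.not_bddAbove_range_of_wellFoundedLT
  simpa using h.symm.subset hk

theorem exists_eqOn_Icc_of_strictMono {α : Type*} {N : ℕ → ℕ} (hN : StrictMono N)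
    {σ : ℕ → ℕ → α} (hσ : ∀ i, σ i (N (i + 1)) = σ (i + 1) (N (i + 1))) :
    ∃ ρ : ℕ → α, ∀ i, Set.EqOn ρ (σ i) (Set.Icc (N i) (N (i + 1))) := by
  have block_unique (k : ℕ) : ∃ i, ∀ j, k ∈ Set.Ico (N j) (N (j + 1)) → j = i := by
    by_cases h : ∃ i, k ∈ Set.Ico (N i) (N (i + 1))
    · obtain ⟨i, hi⟩ := h
      refine ⟨i, fun j hj => ?_⟩
      have hij := hN.lt_iff_lt.mp (hi.1.trans_lt hj.2)
      have hji := hN.lt_iff_lt.mp (hj.1.trans_lt hi.2)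
      omega
    · exact ⟨0, fun j hj => absurd ⟨j, hj⟩ h⟩
  choose block hblock using block_unique
  refine ⟨fun k => σ (block k) k, fun i k hk => ?_⟩
  dsimp only
  rcases hk.2.eq_or_lt with rfl | hlt
  · rw [← hblock _ (i + 1) ⟨le_rfl, hN (i + 1).lt_succ_self⟩, hσ]
  · rw [← hblock k i ⟨hk.1, hlt⟩]

section Ramsey

variable {T : Type*}

/-- A coloring of the segments `[i, j)` of `ℕ` is merge-stable if two segments with the same right
end and the same color keep equal colors when both are extended to the right. It is a weakening
of the additivity assumed in the additive Ramsey theorem. -/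
def IsMergeStable (c : ℕ → ℕ → T) : Prop :=
  ∀ ⦃i j k l⦄, i ≤ k → j ≤ k → k ≤ l → c i k = c j k → c i l = c j l

/-- The coloring `c` of the segments `[i, j)` of `ℕ` has Ramsey type `(s, e)` if some `[0, n)` has
color `s` and infinitely many `m` merge with `n` and have `[n, m)` of color `e`. For merge-stable
colorings this produces a factorization of `ℕ` whose blocks have colors `s, e, e, …`, and unlike
the existence of such a factorization it is visibly a Borel condition on `c`. -/
def HasRamseyType (c : ℕ → ℕ → T) (s e : T) : Prop :=
  ∃ n > 0, c 0 n = s ∧ ∀ b, ∃ m > b, n < m ∧ c n m = e ∧ ∃ k ≥ m, c n k = c m k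

theorem exists_hasRamseyType [Finite T] (c : ℕ → ℕ → T) : ∃ s e, HasRamseyType c s e := by
  let U := Filter.hyperfilter ℕ
  have eventually_gt (b : ℕ) : ∀ᶠ k in (U : Filter ℕ), b < k :=
    Nat.hyperfilter_le_atTop (Filter.eventually_gt_atTop b)
  have exists_limit (f : ℕ → T) : ∃ t, ∀ᶠ k in (U : Filter ℕ), f k = t :=
    U.eventually_exists_iff.mp (.of_forall fun k => ⟨f k, rfl⟩)
  -- `d n` is the limit of `c n` along `U`, and `e` the limit of `d`: positions `n` with `d n = e`
  -- merge pairwise, because `c n` and `c m` both take the value `e` on a common set of `U`.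
  choose d hd using fun n => exists_limit (c n)
  obtain ⟨e, he⟩ := exists_limit d
  obtain ⟨n, hne, hn⟩ := (he.and (eventually_gt 0)).exists
  refine ⟨_, e, n, hn, rfl, fun b => ?_⟩
  obtain ⟨m, hme, hm, hbm, hnm⟩ :=
    (he.and ((hd n).and ((eventually_gt b).and (eventually_gt n)))).exists
  obtain ⟨k, hk, hk', hmk⟩ := ((hd n).and ((hd m).and (eventually_gt m))).exists
  exact ⟨m, hbm, hnm, hm.trans hne, k, hmk.le, by rw [hk, hk', hne, hme]⟩

theorem HasRamseyType.exists_strictMono {c : ℕ → ℕ → T} {s e : T} (h : HasRamseyType c s e)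
    (hc : IsMergeStable c) :
    ∃ N : ℕ → ℕ, StrictMono N ∧ N 0 = 0 ∧
      ∀ i, c (N i) (N (i + 1)) = if i = 0 then s else e := by
  obtain ⟨n, hn, hs, hinf⟩ := h
  let G : Set ℕ := {m | n ≤ m ∧ ∃ k ≥ m, c n k = c m k}
  have exists_next (m : G) : ∃ m' : G, m.1 < m'.1 ∧ c m m' = e := by
    obtain ⟨m, hnm, k, hmk, hk⟩ := m
    obtain ⟨m', hkm', hnm', he, hmerge⟩ := hinf k
    refine ⟨⟨m', hnm'.le, hmerge⟩, hmk.trans_lt hkm', ?_⟩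
    rw [← he, hc (hnm.trans hmk) hmk hkm'.le hk]
  choose next lt_next color_next using exists_next
  let g (i : ℕ) : G := next^[i] ⟨n, le_rfl, n, le_rfl, rfl⟩
  have g_succ (i : ℕ) : g (i + 1) = next (g i) := Function.iterate_succ_apply' next i _
  refine ⟨fun i => Nat.casesOn i 0 fun j => (g j).1, strictMono_nat_of_lt_succ ?_, rfl, ?_⟩
  · rintro (_ | i)
    · exact hn
    · exact (lt_next (g i)).trans_eq (congrArg _ (g_succ i).symm)
  · rintro (_ | i)
    · exact hs
    · simp only [Nat.add_eq_zero_iff, one_ne_zero, and_false, if_false, g_succ, color_next]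

variable {Ω : Type*} [MeasurableSpace Ω] [MeasurableSpace T]

theorem measurableSet_setOf_hasRamseyType [MeasurableEq T] {c : Ω → ℕ → ℕ → T}
    (hc : ∀ i j, Measurable fun ω => c ω i j) (s e : T) :
    MeasurableSet {ω | HasRamseyType (c ω) s e} := by
  refine measurableSet_setOfPred.mpr <| .exists fun n => measurable_const.and <|
    ((hc 0 n).eq measurable_const).and <| .forall fun b => .exists fun m => measurable_const.and <|
    measurable_const.and <| ((hc n m).eq measurable_const).and <| .exists fun k =>
    measurable_const.and ((hc n k).eq (hc m k))

theorem measurableSet_of_forall_factorization [Finite T] [MeasurableSingletonClass T]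
    {c : Ω → ℕ → ℕ → T} (hc : ∀ i j, Measurable fun ω => c ω i j)
    (hstable : ∀ ω, IsMergeStable (c ω)) {L : Set Ω}
    (hL : ∀ ⦃ω ω'⦄ ⦃N N' : ℕ → ℕ⦄, StrictMono N → N 0 = 0 → StrictMono N' → N' 0 = 0 →
      (∀ i, c ω (N i) (N (i + 1)) = c ω' (N' i) (N' (i + 1))) → ω ∈ L → ω' ∈ L) :
    MeasurableSet L := by
  let type (t : T × T) : Set Ω := {ω | HasRamseyType (c ω) t.1 t.2}
  have type_subset {t : T × T} {ω : Ω} (hω : ω ∈ type t) (hωL : ω ∈ L) : type t ⊆ L := by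
    intro ω' hω'
    obtain ⟨N, hN, hN0, hcN⟩ := hω.exists_strictMono (hstable ω)
    obtain ⟨N', hN', hN'0, hcN'⟩ := hω'.exists_strictMono (hstable ω')
    exact hL hN hN0 hN' hN'0 (fun i => by rw [hcN, hcN']) hωL
  have L_eq : L = ⋃ t ∈ {t | type t ⊆ L}, type t := by
    refine Set.Subset.antisymm (fun ω hω => ?_) (Set.iUnion₂_subset fun t ht => ht)
    obtain ⟨s, e, h⟩ := exists_hasRamseyType (c ω)
    exact Set.mem_biUnion (x := (s, e)) (type_subset h hω) h
  rw [L_eq]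
  exact .biUnion (Set.to_countable _) fun t _ => measurableSet_setOf_hasRamseyType hc t.1 t.2

end Ramsey

section Segments

variable {A : Type*}

/-- The factor `w i, …, w (j - 1)` of an infinite word `w`. -/
def wordSegment (w : ℕ → A) (i j : ℕ) : List A :=
  (List.Ico i j).map w

theorem wordSegment_self (w : ℕ → A) (i : ℕ) : wordSegment w i i = [] := by
  simp only [wordSegment, List.Ico.self_empty, List.map_nil]

theorem wordSegment_succ (w : ℕ → A) {i j : ℕ} (h : i ≤ j) :
    wordSegment w i (j + 1) = wordSegment w i j ++ [w j] := by
  simp only [wordSegment, List.Ico.succ_top h, List.map_append, List.map_singleton]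

theorem wordSegment_append (w : ℕ → A) {i j k : ℕ} (hij : i ≤ j) (hjk : j ≤ k) :
    wordSegment w i j ++ wordSegment w j k = wordSegment w i k := by
  simp only [wordSegment, ← List.map_append, List.Ico.append_consecutive hij hjk]

theorem length_wordSegment (w : ℕ → A) (i j : ℕ) : (wordSegment w i j).length = j - i := by
  simp only [wordSegment, List.length_map, List.Ico.length]

theorem measurable_comp_wordSegment [Countable A] [MeasurableSpace A] [MeasurableSingletonClass A]
    {T : Type*} [MeasurableSpace T] (φ : List A → T) (i j : ℕ) :
    Measurable fun w : ℕ → A => φ (wordSegment w i j) := by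
  simp only [wordSegment]
  induction List.Ico i j generalizing φ with
  | nil => simp only [List.map_nil, measurable_const]
  | cons a l ih =>
    have h : Measurable fun p : (ℕ → A) × A => φ (p.2 :: l.map p.1) :=
      measurable_from_prod_countable_left fun b => ih fun x => φ (b :: x)
    exact h.comp (measurable_id.prodMk (measurable_pi_apply a))

end Segments

section Automata

variable {A Q : Type*} {M : NFA A Q} {w : ℕ → A} {i j : ℕ}

/-- The states `ρ i, …, ρ j` form a run of `M` on the factor `w i, …, w (j - 1)` of `w`. -/
def IsRunOn (M : NFA A Q) (w : ℕ → A) (i j : ℕ) (ρ : ℕ → Q) : Prop :=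
  ∀ k ∈ Set.Ico i j, ρ (k + 1) ∈ M.step (ρ k) (w k)

theorem isRunOn_congr {ρ σ : ℕ → Q} (h : Set.EqOn ρ σ (Set.Icc i j)) :
    IsRunOn M w i j ρ ↔ IsRunOn M w i j σ :=
  forall₂_congr fun k hk => by rw [h ⟨hk.1, hk.2.le⟩, h ⟨hk.1.trans k.le_succ, hk.2⟩]

theorem isRunOn_succ (hij : i ≤ j) {ρ : ℕ → Q} :
    IsRunOn M w i (j + 1) ρ ↔ IsRunOn M w i j ρ ∧ ρ (j + 1) ∈ M.step (ρ j) (w j) := by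
  simp only [IsRunOn, ← Order.succ_eq_add_one, ← Set.insert_Ico_right_eq_Ico_succ hij,
    Set.forall_mem_insert, and_comm]

/-- The automaton that simulates `M` and records in its second component whether an accepting state
of `M` has been entered, the state in which the simulation starts not being counted. -/
def acceptTracker (M : NFA A Q) : NFA A (Q × Prop) where
  step s a := {t | t.1 ∈ M.step s.1 a ∧ (t.2 ↔ s.2 ∨ t.1 ∈ M.accept)}
  start := M.start ×ˢ {False}
  accept := {s | s.2}

theorem mem_step_acceptTracker_iff {s t : Q × Prop} {a : A} :
    t ∈ (acceptTracker M).step s a ↔ t.1 ∈ M.step s.1 a ∧ (t.2 ↔ s.2 ∨ t.1 ∈ M.accept) :=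
  Iff.rfl

theorem mem_evalFrom_append_singleton_iff {S : Set Q} {x : List A} {a : A} {q : Q} :
    q ∈ M.evalFrom S (x ++ [a]) ↔ ∃ p ∈ M.evalFrom S x, q ∈ M.step p a := by
  rw [NFA.evalFrom_append, NFA.evalFrom_singleton, NFA.mem_stepSet]

theorem exists_mem_Ioc_add_one_iff {P : ℕ → Prop} (hij : i ≤ j) :
    (∃ k ∈ Set.Ioc i (j + 1), P k) ↔ (∃ k ∈ Set.Ioc i j, P k) ∨ P (j + 1) := by
  rw [← Order.succ_eq_add_one, ← Set.insert_Ioc_right_eq_Ioc_succ hij, Set.exists_mem_insert,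
    or_comm]

theorem mem_evalFrom_acceptTracker_iff (hij : i ≤ j) {p q : Q} {b : Prop} :
    (q, b) ∈ (acceptTracker M).evalFrom {(p, False)} (wordSegment w i j) ↔
      ∃ ρ : ℕ → Q, IsRunOn M w i j ρ ∧ ρ i = p ∧ ρ j = q ∧
        (b ↔ ∃ k ∈ Set.Ioc i j, ρ k ∈ M.accept) := by
  induction j, hij using Nat.le_induction generalizing q b with
  | base =>
    simp only [wordSegment_self, NFA.evalFrom_nil, Set.mem_singleton_iff, Prod.mk.injEq,
      IsRunOn, Set.Ico_self, Set.Ioc_self, Set.mem_empty_iff_false, false_and, exists_false,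
      iff_false, IsEmpty.forall_iff, implies_true, true_and, eq_iff_iff]
    constructor
    · rintro ⟨rfl, hb⟩
      exact ⟨fun _ => q, rfl, rfl, hb⟩
    · rintro ⟨ρ, rfl, rfl, hb⟩
      exact ⟨rfl, hb⟩
  | succ j hij ih =>
    simp only [wordSegment_succ w hij, mem_evalFrom_append_singleton_iff, Prod.exists, ih,
      mem_step_acceptTracker_iff, isRunOn_succ hij, exists_mem_Ioc_add_one_iff hij]
    constructor
    · rintro ⟨r, b', ⟨ρ, hρ, rfl, rfl, hb'⟩, hq, hb⟩
      have eqOn : Set.EqOn (Function.update ρ (j + 1) q) ρ (Set.Icc i j) := fun k hk =>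
        Function.update_of_ne (Nat.lt_succ_of_le hk.2).ne _ _
      refine ⟨Function.update ρ (j + 1) q, ⟨(isRunOn_congr eqOn).mpr hρ, ?_⟩,
        eqOn ⟨le_rfl, hij⟩, Function.update_self _ _ _, ?_⟩
      · rwa [Function.update_self, eqOn ⟨hij, le_rfl⟩]
      · rw [hb, Function.update_self, hb']
        exact or_congr_left (exists_congr fun k => and_congr_right fun hk => by
          rw [eqOn ⟨hk.1.le, hk.2⟩])
    · rintro ⟨ρ, ⟨hρ, hstep⟩, rfl, rfl, hb⟩
      exact ⟨ρ j, _, ⟨ρ, hρ, rfl, rfl, Iff.rfl⟩, hstep, hb⟩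

theorem exists_blocks_of_mem_buchiLanguage {N : ℕ → ℕ} (hN : StrictMono N) (hN0 : N 0 = 0)
    (hw : w ∈ M.buchiLanguage) :
    ∃ (q : ℕ → Q) (b : ℕ → Prop), q 0 ∈ M.start ∧
      (∀ i, (q (i + 1), b i) ∈
        (acceptTracker M).evalFrom {(q i, False)} (wordSegment w (N i) (N (i + 1)))) ∧
      {i | b i}.Infinite := by
  obtain ⟨ρ, hρ0, hρ, hacc⟩ := hw
  refine ⟨fun i => ρ (N i), fun i => ∃ k ∈ Set.Ioc (N i) (N (i + 1)), ρ k ∈ M.accept,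
    by rwa [← hN0] at hρ0, fun i => ?_, Set.infinite_of_forall_exists_gt fun m => ?_⟩
  · exact (mem_evalFrom_acceptTracker_iff (hN.monotone i.le_succ)).mpr
      ⟨ρ, fun k _ => hρ k, rfl, rfl, Iff.rfl⟩
  · obtain ⟨k, hk, hmk⟩ := hacc.exists_gt (N (m + 1))
    obtain ⟨i, hi⟩ := exists_mem_Ico_of_strictMono hN (k := k - 1) (by omega)
    have hki : k ∈ Set.Ioc (N i) (N (i + 1)) := by
      simp only [Set.mem_Ico, Set.mem_Ioc] at hi ⊢
      omega
    exact ⟨i, ⟨k, hki, hk⟩, Nat.succ_lt_succ_iff.mp (hN.lt_iff_lt.mp (hmk.trans_le hki.2))⟩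

theorem mem_buchiLanguage_of_exists_blocks {N : ℕ → ℕ} (hN : StrictMono N) (hN0 : N 0 = 0)
    {q : ℕ → Q} {b : ℕ → Prop} (hq0 : q 0 ∈ M.start)
    (hq : ∀ i, (q (i + 1), b i) ∈
      (acceptTracker M).evalFrom {(q i, False)} (wordSegment w (N i) (N (i + 1))))
    (hb : {i | b i}.Infinite) : w ∈ M.buchiLanguage := by
  simp only [mem_evalFrom_acceptTracker_iff (hN.monotone (Nat.le_succ _))] at hq
  choose σ hσ hleft hright hacc using hq
  obtain ⟨ρ, hρ⟩ := exists_eqOn_Icc_of_strictMono hN fun i => (hright i).trans (hleft (i + 1)).symm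
  refine ⟨ρ, ?_, fun k => ?_, Set.infinite_of_forall_exists_gt fun m => ?_⟩
  · have h := hρ 0 ⟨le_rfl, hN.monotone (Nat.le_succ 0)⟩
    rw [hleft, hN0] at h
    rwa [h]
  · obtain ⟨i, hi⟩ := exists_mem_Ico_of_strictMono hN (hN0.trans_le k.zero_le)
    exact (isRunOn_congr (hρ i)).mpr (hσ i) k hi
  · obtain ⟨i, hi, hmi⟩ := hb.exists_gt m
    obtain ⟨k, hk, hka⟩ := (hacc i).mp hi
    refine ⟨k, ?_, hmi.trans_le ((hN.id_le i).trans hk.1.le)⟩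
    rwa [Set.mem_ofPred_eq, hρ i ⟨hk.1.le, hk.2⟩]

theorem measurableSet_buchiLanguage [Countable A] [MeasurableSpace A] [MeasurableSingletonClass A]
    [Finite Q] (M : NFA A Q) : MeasurableSet M.buchiLanguage := by
  let _ : MeasurableSpace (Set (Q × Prop) → Set (Q × Prop)) := ⊤
  refine measurableSet_of_forall_factorization
    (c := fun w i j S => (acceptTracker M).evalFrom S (wordSegment w i j))
    (fun i j => measurable_comp_wordSegment (fun x S => (acceptTracker M).evalFrom S x) i j)
    (fun w i j k l hik hjk hkl h => ?_) (fun w v N N' hN hN0 hN' hN'0 h hw => ?_)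
  · funext S
    simp only [← wordSegment_append w hik hkl, ← wordSegment_append w hjk hkl, NFA.evalFrom_append,
      congrFun h S]
  · obtain ⟨q, b, hq0, hq, hb⟩ := exists_blocks_of_mem_buchiLanguage hN hN0 hw
    refine mem_buchiLanguage_of_exists_blocks hN' hN'0 hq0 (fun i => ?_) hb
    rw [← congrFun (h i)]
    exact hq i

end Automata

section LeftQuotients

variable {A Q : Type*}

theorem prependWord_cons_zero (a : A) (x : List A) (w : ℕ → A) : prependWord (a :: x) w 0 = a := by
  simp [prependWord]

theorem prependWord_cons_add_one (a : A) (x : List A) (w : ℕ → A) (n : ℕ) :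
    prependWord (a :: x) w (n + 1) = prependWord x w n := by
  simp [prependWord]

theorem prependWord_cons_mem_buchiLanguage_iff (M : NFA A Q) (S : Set Q) (a : A) (x : List A)
    (w : ℕ → A) :
    prependWord (a :: x) w ∈ ({ M with start := S } : NFA A Q).buchiLanguage ↔
      prependWord x w ∈ ({ M with start := M.stepSet S a } : NFA A Q).buchiLanguage := by
  have infinite_shift (P : ℕ → Prop) : {i | P (i + 1)}.Infinite ↔ {i | P i}.Infinite := by
    simp only [← Nat.frequently_atTop_iff_infinite, ← Filter.frequently_map (m := (· + 1)),
      Filter.map_add_atTop_eq_nat]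
  constructor
  · rintro ⟨ρ, hρ0, hρ, hacc⟩
    refine ⟨fun i => ρ (i + 1), ?_, fun i => ?_, (infinite_shift (ρ · ∈ M.accept)).mpr hacc⟩
    · exact NFA.mem_stepSet.mpr ⟨ρ 0, hρ0, by simpa only [prependWord_cons_zero] using hρ 0⟩
    · simpa only [prependWord_cons_add_one] using hρ (i + 1)
  · rintro ⟨ρ, hρ0, hρ, hacc⟩
    obtain ⟨q, hq, hstep⟩ := NFA.mem_stepSet.mp hρ0
    refine ⟨fun i => Nat.casesOn i q ρ, hq, ?_, (infinite_shift _).mp hacc⟩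
    rintro (_ | i)
    · rwa [prependWord_cons_zero]
    · simpa only [prependWord_cons_add_one] using hρ i

theorem prependWord_mem_buchiLanguage_iff (M : NFA A Q) (x : List A) (w : ℕ → A) :
    prependWord x w ∈ M.buchiLanguage ↔
      w ∈ ({ M with start := M.evalFrom M.start x } : NFA A Q).buchiLanguage := by
  suffices ∀ S : Set Q, prependWord x w ∈ ({ M with start := S } : NFA A Q).buchiLanguage ↔
      w ∈ ({ M with start := M.evalFrom S x } : NFA A Q).buchiLanguage from this M.start
  induction x with
  | nil => exact fun S => Iff.rfl
  | cons a x ih => exact fun S => (prependWord_cons_mem_buchiLanguage_iff M S a x w).trans (ih _)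

variable {L : Set (ℕ → A)}

theorem IsOmegaRegular.finite_range_preimage_prependWord (hL : IsOmegaRegular L) :
    (Set.range fun x => prependWord x ⁻¹' L).Finite := by
  obtain ⟨Q, hQ, M, rfl⟩ := hL
  refine (Set.finite_range fun S : Set Q =>
    ({ M with start := S } : NFA A Q).buchiLanguage).subset ?_
  rintro _ ⟨x, rfl⟩
  exact ⟨M.evalFrom M.start x, Set.ext fun w => (prependWord_mem_buchiLanguage_iff M x w).symm⟩

theorem IsOmegaRegular.measurableSet [Countable A] [MeasurableSpace A] [MeasurableSingletonClass A]
    (hL : IsOmegaRegular L) : MeasurableSet L := by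
  obtain ⟨Q, hQ, M, rfl⟩ := hL
  exact measurableSet_buchiLanguage M

end LeftQuotients

section Cylinders

variable {A : Type*}

theorem preimage_wordSegment_singleton (x : List A) :
    (fun w => wordSegment w 0 x.length) ⁻¹' {x} = wordCylinder x := by
  ext w
  simp [wordSegment, List.Ico.zero_bot, wordCylinder, List.ext_getElem_iff]

theorem mem_wordCylinder_append_iff {x y : List A} {w : ℕ → A} :
    w ∈ wordCylinder (x ++ y) ↔
      w ∈ wordCylinder x ∧ (fun n => w (n + x.length)) ∈ wordCylinder y := by
  simp only [wordCylinder, Set.mem_ofPred_eq, List.length_append]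
  constructor
  · intro h
    refine ⟨fun i hi => ?_, fun i hi => ?_⟩
    · rw [h i (by omega), List.getElem_append_left hi]
    · simp [h (i + x.length) (by omega)]
  · rintro ⟨hx, hy⟩ i hi
    rw [List.getElem_append]
    split_ifs with hix
    · exact hx i hix
    · rw [← hy (i - x.length) (by omega), Nat.sub_add_cancel (not_lt.mp hix)]

theorem prependWord_shift {x : List A} {w : ℕ → A} (hw : w ∈ wordCylinder x) :
    prependWord x (fun n => w (n + x.length)) = w := by
  funext n
  unfold prependWord
  split_ifs with hn
  · exact (hw n hn).symm
  · exact congrArg w (Nat.sub_add_cancel (not_lt.mp hn))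

variable [MeasurableSpace A]

theorem measurable_prependWord (x : List A) : Measurable (prependWord x) := by
  refine measurable_pi_lambda _ fun n => ?_
  unfold prependWord
  split_ifs <;> fun_prop

theorem measurableSet_wordCylinder [MeasurableSingletonClass A] (x : List A) :
    MeasurableSet (wordCylinder x) := by
  simp only [wordCylinder, Set.ofPred_forall]
  exact .iInter fun i => .iInter fun h => measurable_pi_apply i (measurableSet_singleton _)

end Cylinders

theorem measure_le_of_generateFrom_isSetAlgebra {Ω : Type*} {mΩ : MeasurableSpace Ω}
    {μ ν : Measure Ω} [IsFiniteMeasure μ] [IsFiniteMeasure ν] {C : Set (Set Ω)}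
    (hC : IsSetAlgebra C) (hgen : mΩ = MeasurableSpace.generateFrom C)
    (h : ∀ s ∈ C, ν s ≤ μ s) : ν ≤ μ := by
  refine Measure.le_iff.mpr fun s hs => ENNReal.le_of_forall_pos_le_add fun ε hε _ => ?_
  have cover : ∃ D : Set (Set Ω), D.Countable ∧ D ⊆ C ∧ (ν + μ) (⋃₀ D)ᶜ = 0 :=
    ⟨{Set.univ}, Set.countable_singleton _, Set.singleton_subset_iff.mpr hC.univ_mem, by simp⟩
  obtain ⟨t, ht, hts⟩ := exists_measure_symmDiff_lt_of_generateFrom_isSetRing hC.isSetRing cover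
    hgen hs (ENNReal.coe_pos.mpr hε)
  calc ν s ≤ ν (symmDiff t s ∪ t) := measure_mono (le_symmDiff_sup_left t s)
    _ ≤ ν (symmDiff t s) + ν t := measure_union_le _ _
    _ ≤ ν (symmDiff t s) + μ t := by grw [h t ht]
    _ ≤ ν (symmDiff t s) + μ (symmDiff t s ∪ s) := by
        gcongr
        exact le_symmDiff_sup_right t s
    _ ≤ ν (symmDiff t s) + (μ (symmDiff t s) + μ s) := by grw [measure_union_le]
    _ = μ s + (ν + μ) (symmDiff t s) := by rw [Measure.add_apply]; ring
    _ ≤ μ s + ε := by grw [hts]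

section Domination

variable {A : Type*} [Countable A] [MeasurableSpace A] [MeasurableSingletonClass A]
  {μ ν : Measure (ℕ → A)}

theorem measure_preimage_wordSegment_le (h : ∀ x, ν (wordCylinder x) ≤ μ (wordCylinder x)) (n : ℕ)
    (S : Set (List A)) :
    ν ((fun w => wordSegment w 0 n) ⁻¹' S) ≤ μ ((fun w => wordSegment w 0 n) ⁻¹' S) := by
  let _ : MeasurableSpace (List A) := ⊤
  have hmeas : Measurable fun w : ℕ → A => wordSegment w 0 n := measurable_comp_wordSegment id 0 n
  have fibre_le (x : List A) : ν ((fun w => wordSegment w 0 n) ⁻¹' {x}) ≤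
      μ ((fun w => wordSegment w 0 n) ⁻¹' {x}) := by
    obtain rfl | hx := eq_or_ne n x.length
    · simpa only [preimage_wordSegment_singleton] using h x
    · have : (fun w : ℕ → A => wordSegment w 0 n) ⁻¹' {x} = ∅ := by
        refine Set.eq_empty_of_forall_notMem fun w hw => hx ?_
        rw [← Set.mem_singleton_iff.mp hw, length_wordSegment, Nat.sub_zero]
      simp only [this, measure_empty, le_rfl]
  rw [← tsum_measure_preimage_singleton (Set.to_countable S) fun x _ => hmeas trivial,
    ← tsum_measure_preimage_singleton (Set.to_countable S) fun x _ => hmeas trivial]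
  exact ENNReal.tsum_le_tsum fun x => fibre_le x

theorem measure_le_of_forall_wordCylinder_le [IsFiniteMeasure μ] [IsFiniteMeasure ν]
    (h : ∀ x, ν (wordCylinder x) ≤ μ (wordCylinder x)) : ν ≤ μ := by
  refine measure_le_of_generateFrom_isSetAlgebra isSetAlgebra_measurableCylinders
    generateFrom_measurableCylinders.symm fun s hs => ?_
  rw [measurableCylinders_nat] at hs
  simp only [Set.mem_iUnion, Set.mem_singleton_iff] at hs
  obtain ⟨n, S, -, rfl⟩ := hs
  have : cylinder (Finset.Iic n) S = (fun w => wordSegment w 0 (n + 1)) ⁻¹'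
      ((fun w => wordSegment w 0 (n + 1)) '' cylinder (Finset.Iic n) S) := by
    refine (Set.subset_preimage_image _ _).antisymm ?_
    rintro w ⟨v, hv, hvw⟩
    simp only [wordSegment, List.map_inj_left, List.Ico.mem] at hvw
    rw [mem_cylinder] at hv ⊢
    convert hv using 1
    funext i
    exact (hvw i ⟨i.1.zero_le, Nat.lt_succ_of_le (Finset.mem_Iic.mp i.2)⟩).symm
  rw [this]
  exact measure_preimage_wordSegment_le h _ _

end Domination

/-- A measure on infinite words is Bernoulli if the letters are independent and identically
distributed; this is encoded as multiplicativity of `x ↦ μ (wordCylinder x)`. -/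
def IsBernoulliMeasure {A : Type*} [MeasurableSpace A] (μ : Measure (ℕ → A)) : Prop :=
  ∀ x y, μ (wordCylinder (x ++ y)) = μ (wordCylinder x) * μ (wordCylinder y)

namespace IsBernoulliMeasure

variable {A : Type*} [Countable A] [MeasurableSpace A] [MeasurableSingletonClass A]
  {μ : Measure (ℕ → A)} [IsFiniteMeasure μ] {L : Set (ℕ → A)}

theorem map_restrict_wordCylinder_shift (hμ : IsBernoulliMeasure μ) (x : List A) :
    (μ.restrict (wordCylinder x)).map (fun w n => w (n + x.length)) = μ (wordCylinder x) • μ := by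
  have measurable_shift : Measurable fun (w : ℕ → A) n => w (n + x.length) := by fun_prop
  have eq_on_cylinder (y : List A) :
      (μ.restrict (wordCylinder x)).map (fun w n => w (n + x.length)) (wordCylinder y) =
        (μ (wordCylinder x) • μ) (wordCylinder y) := by
    rw [Measure.map_apply measurable_shift (measurableSet_wordCylinder y),
      Measure.restrict_apply (measurable_shift (measurableSet_wordCylinder y)),
      Measure.smul_apply, smul_eq_mul, ← hμ x y]
    congr 1
    ext w
    exact and_comm.trans mem_wordCylinder_append_iff.symm
  have : IsFiniteMeasure (μ (wordCylinder x) • μ) := Measure.smul_finite μ (measure_ne_top μ _)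
  exact le_antisymm (measure_le_of_forall_wordCylinder_le fun y => (eq_on_cylinder y).le)
    (measure_le_of_forall_wordCylinder_le fun y => (eq_on_cylinder y).ge)

theorem measure_inter_wordCylinder (hμ : IsBernoulliMeasure μ) (hL : MeasurableSet L)
    (x : List A) : μ (L ∩ wordCylinder x) = μ (prependWord x ⁻¹' L) * μ (wordCylinder x) := by
  let shift (w : ℕ → A) (n : ℕ) : A := w (n + x.length)
  have measurable_shift : Measurable shift := by fun_prop
  have measurableSet_quotient := measurable_prependWord x hL
  calc μ (L ∩ wordCylinder x)
      = μ (shift ⁻¹' (prependWord x ⁻¹' L) ∩ wordCylinder x) := by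
        congr 1
        ext w
        refine and_congr_left fun hw => ?_
        rw [Set.mem_preimage, Set.mem_preimage, prependWord_shift hw]
    _ = (μ.restrict (wordCylinder x)).map shift (prependWord x ⁻¹' L) := by
        rw [Measure.map_apply measurable_shift measurableSet_quotient,
          Measure.restrict_apply (measurable_shift measurableSet_quotient)]
    _ = μ (prependWord x ⁻¹' L) * μ (wordCylinder x) := by
        rw [hμ.map_restrict_wordCylinder_shift, Measure.smul_apply, smul_eq_mul, mul_comm]

theorem one_le_iSup_measure_preimage_prependWord (hμ : IsBernoulliMeasure μ)
    (hL : MeasurableSet L) (hpos : μ L ≠ 0) : 1 ≤ ⨆ x, μ (prependWord x ⁻¹' L) := by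
  set c := ⨆ x, μ (prependWord x ⁻¹' L) with hc
  by_contra! hlt
  have : IsFiniteMeasure (c • μ) := Measure.smul_finite μ hlt.ne_top
  have restrict_le : μ.restrict L ≤ c • μ := measure_le_of_forall_wordCylinder_le fun x => by
    rw [Measure.restrict_apply (measurableSet_wordCylinder x), Set.inter_comm,
      hμ.measure_inter_wordCylinder hL, Measure.smul_apply, smul_eq_mul, hc]
    gcongr
    exact le_iSup (fun x => μ (prependWord x ⁻¹' L)) x
  have self_le : μ L ≤ c * μ L := by
    simpa only [Measure.restrict_apply_self, Measure.smul_apply, smul_eq_mul] using restrict_le L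
  have mul_self_lt : c * μ L < 1 * μ L := ENNReal.mul_lt_mul_left hpos (measure_ne_top μ L) hlt
  exact self_le.not_gt (mul_self_lt.trans_eq (one_mul _))

end IsBernoulliMeasure

theorem isBernoulliMeasure_uniformWordMeasure (A : Type*) [Fintype A] [Nonempty A]
    [MeasurableSpace A] [MeasurableSingletonClass A] :
    IsBernoulliMeasure (uniformWordMeasure A) := fun x y => by
  simp only [uniformWordMeasure_wordCylinder, List.length_append, pow_add, one_div]
  exact ENNReal.mul_inv (by simp) (by simp)

instance isProbabilityMeasure_uniformWordMeasure (A : Type*) [Fintype A] [Nonempty A]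
    [MeasurableSpace A] : IsProbabilityMeasure (uniformWordMeasure A) := by
  unfold uniformWordMeasure
  infer_instance

theorem mainTheorem9_general {A : Type*} [Countable A] [MeasurableSpace A]
    [MeasurableSingletonClass A] (μ : Measure (ℕ → A)) [IsProbabilityMeasure μ]
    (hμ : IsBernoulliMeasure μ) (L : Set (ℕ → A)) (hL : IsOmegaRegular L) (hpos : 0 < μ L) :
    ∃ x : List A, MeasurableSet {w : ℕ → A | prependWord x w ∈ L} ∧
      μ {w : ℕ → A | prependWord x w ∈ L} = 1 := by
  have finite_range : (Set.range fun x => μ (prependWord x ⁻¹' L)).Finite := by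
    rw [← Function.comp_def μ, Set.range_comp]
    exact hL.finite_range_preimage_prependWord.image μ
  obtain ⟨x, hx⟩ := (Set.range_nonempty _).csSup_mem finite_range
  have one_le := hμ.one_le_iSup_measure_preimage_prependWord hL.measurableSet hpos.ne'
  exact ⟨x, measurable_prependWord x hL.measurableSet,
    prob_le_one.antisymm (one_le.trans_eq hx.symm)⟩

theorem mainTheorem9 {A : Type*} [Fintype A] [Nontrivial A] [MeasurableSpace A]
    [MeasurableSingletonClass A] (L : Set (ℕ → A)) (hL : IsOmegaRegular L)
    (hpos : 0 < uniformWordMeasure A L) :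
    ∃ x : List A, MeasurableSet {w : ℕ → A | prependWord x w ∈ L} ∧
      uniformWordMeasure A {w : ℕ → A | prependWord x w ∈ L} = 1 :=
  mainTheorem9_general _ (isBernoulliMeasure_uniformWordMeasure A) L hL hpos
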